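/- Let $G$ be a finite simple graph of order $n$ with adjacency matrix $A$, degree diagonal matrix $D$ and minimum degree $\delta$. Let $\kappa'(G)$ be the edge connectivity of $G$ and $e(X,Y)$ the number of edges with one end in $X$ and the other in $Y$. Suppose that $G \in \mathcal{G}_1$, that is, there are two disjoint non-empty proper subsets $V_1, V_2$ of $V(G)$ with $V(G)\setminus(V_1\cup V_2)\neq\emptyset$ and $e(V_i, V(G)\setminus V_i)=\kappa'(G)$ for $i=1,2$. Let $k\ge 2$ be an integer with $\delta\ge 2k+2$, and let $a,b$ be real numbers with $a\ge -1$, $b\ne 0$ and $a/b\ge -1$. Denote by $\lambda_i(M)$ the $i$-th largest eigenvalue, counted with multiplicity, of a real symmetric matrix $M$. If at least one of the following conditions holds: 1. $\lambda_3(aD+A) < (a+1)\delta - \dfrac{16\left(k+\frac{\delta-1}{\delta}\right)}{3(\delta+1)}$; 2. $b>0$ and $\lambda_3(aD+bA) < (a+b)\delta - \dfrac{16b\left(k+\frac{\delta-1}{\delta}\right)}{3(\delta+1)}$; 3. $b<0$ and $\lambda_{n-2}(aD+bA) > (a+b)\delta - \dfrac{16b\left(k+\frac{\delta-1}{\delta}\right)}{3(\delta+1)}$;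 then $G$ has property $P(k,\delta)$: $G$ contains $k$ pairwise edge-disjoint spanning trees and a further forest $F$, edge-disjoint from all of them, with $|E(F)| > \frac{\delta-1}{\delta}(n-1)$, such that if $F$ is not a spanning tree, then $F$ has a component with at least $\delta$ edges. -/

import Mathlib

namespace SpectralPacking

variable {V : Type*}

/-- The edge connectivity `κ'(G)`: the least number of edges whose deletion leaves a graph that is
not connected (and `0` if no such set of edges exists, that is, if `G` has only one vertex). -/
noncomputable def edgeConnectivity (G : SimpleGraph V) : ℕ :=
  sInf {m : ℕ | ∃ X : Set (Sym2 V), X ⊆ G.edgeSet ∧ X.ncard = m ∧ ¬ (G.deleteEdges X).Connected}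

/-- `e(X, Y)`, the number of edges with one end in `X` and the other in `Y`, used for disjoint `X`
and `Y`: each such edge is then exactly one ordered pair `(x, y)` with `x ∈ X`, `y ∈ Y`. -/
def edgesBetween (G : SimpleGraph V) [DecidableRel G.Adj] (X Y : Finset V) : ℕ :=
  (G.interedges X Y).card

/-- The class `𝒢_t`: there are `t + 1` non-empty, pairwise disjoint, proper vertex subsets that do
not cover the vertex set, each of which has exactly `κ'(G)` edges to its complement. -/
def InClass [Fintype V] [DecidableEq V] (t : ℕ) (G : SimpleGraph V) [DecidableRel G.Adj] : Prop :=
  ∃ W : Fin (t + 1) → Finset V,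
    (∀ i, (W i).Nonempty ∧ W i ≠ Finset.univ) ∧
    (∀ i j, i ≠ j → Disjoint (W i) (W j)) ∧
    (Finset.univ \ Finset.univ.biUnion W).Nonempty ∧
    ∀ i, edgeConnectivity G = edgesBetween G (W i) (Finset.univ \ W i)

/-- The property `P(k, d)`: `G` contains `k` edge-disjoint spanning trees `T 0, …, T (k - 1)` and a
further forest `F`, edge-disjoint from these trees, with more than `((d - 1) / d) (n - 1)` edges;
and if `F` is not a spanning tree, then some component of `F` has at least `d` edges.
Spanning subgraphs of `G` are graphs `H ≤ G` on the same vertex type. -/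
def PropertyP [Fintype V] (G : SimpleGraph V) (k d : ℕ) : Prop :=
  ∃ (T : Fin k → SimpleGraph V) (F : SimpleGraph V),
    (∀ i, T i ≤ G ∧ (T i).IsTree) ∧
    (∀ i j, i ≠ j → Disjoint (T i).edgeSet (T j).edgeSet) ∧
    F ≤ G ∧ F.IsAcyclic ∧
    (∀ i, Disjoint (T i).edgeSet F.edgeSet) ∧
    ((d : ℝ) - 1) / d * ((Fintype.card V : ℝ) - 1) < (F.edgeSet.ncard : ℝ) ∧
    (¬ F.IsTree → ∃ C : F.ConnectedComponent, d ≤ C.toSimpleGraph.edgeSet.ncard)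

/-- The `i`-th largest eigenvalue, counted with multiplicity and starting from `i = 1`, of a real
symmetric matrix of order `n`. The value outside `1 ≤ i ≤ n` is irrelevant. -/
noncomputable def ithLargestEigenvalue [Fintype V] [DecidableEq V] {M : Matrix V V ℝ}
    (hM : M.IsHermitian) (i : ℕ) : ℝ :=
  if h : 1 ≤ i ∧ i ≤ Fintype.card V then hM.eigenvalues₀ ⟨i - 1, by omega⟩ else 0

section
variable [Fintype V] [DecidableEq V] (G : SimpleGraph V) [DecidableRel G.Adj]

/-- The matrix `a D(G) + A(G)`. -/
def degAddAdj (a : ℝ) : Matrix V V ℝ := a • G.degMatrix ℝ + G.adjMatrix ℝ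

/-- The matrix `a D(G) + b A(G)`. -/
def degAddSmulAdj (a b : ℝ) : Matrix V V ℝ := a • G.degMatrix ℝ + b • G.adjMatrix ℝ

theorem degAddSmulAdj_isHermitian (a b : ℝ) : (degAddSmulAdj G a b).IsHermitian := by
  have hD : (G.degMatrix ℝ).transpose = G.degMatrix ℝ := G.isSymm_degMatrix ℝ
  have hA : (G.adjMatrix ℝ).transpose = G.adjMatrix ℝ := G.isSymm_adjMatrix
  simp [Matrix.IsHermitian, degAddSmulAdj, Matrix.conjTranspose_eq_transpose_of_trivial,
    Matrix.transpose_add, Matrix.transpose_smul, hD, hA]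

theorem degAddAdj_isHermitian (a : ℝ) : (degAddAdj G a).IsHermitian := by
  simpa [degAddAdj, degAddSmulAdj] using degAddSmulAdj_isHermitian G a 1

/-- `λ_i(G, a)`, the `i`-th largest eigenvalue of `a D(G) + A(G)`. -/
noncomputable def lam (a : ℝ) (i : ℕ) : ℝ :=
  ithLargestEigenvalue (degAddAdj_isHermitian G a) i

/-- `λ_i(G, a, b)`, the `i`-th largest eigenvalue of `a D(G) + b A(G)`. -/
noncomputable def lam₂ (a b : ℝ) (i : ℕ) : ℝ :=
  ithLargestEigenvalue (degAddSmulAdj_isHermitian G a b) i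

end

end SpectralPacking

/-!
Write `c = k + (δ - 1) / δ`, and `d(U)` for the number of edges leaving a vertex set `U`.

*From eigenvalues to edge cuts.* Each of the three eigenvalue conditions implies that there are no
three disjoint non-empty sets `U` with `d(U) < 2 c`. As `2 c < δ`, such sets have at least `δ + 1`
vertices (`minDegree_lt_card_of_edgesBetween_lt`). On the span of their indicator functions, the form
of `a D + b A = (a + b) D - b L`, with `L` the Laplacian, differs from that of `(a + b) D` by at most
`|b| * 4 c / (δ + 1)` times the squared norm, because `(x - y)² ≤ 2 x² + 2 y²` on the edges leaving
the sets (`exists_testVectors`). The Courant–Fischer bounds then contradict the condition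
(`exists_le_edgesBetween_of_eigenvalue`).

*From edge cuts to partitions.* Membership in `𝒢₁` provides two disjoint sets with `d(U) = κ'`, and the
remaining vertices form a third set with `d(U) ≤ 2 κ'`; hence `κ' ≥ c`
(`le_edgeConnectivity_of_inClass`). In a partition `P` of the vertices into `s` classes, at most two
classes have `d(U) < 2 c`, and these have `d(U) ≥ κ' ≥ c`, so that `e(P) ≥ c (s - 1)`
(`mul_card_sub_one_le_card_crossing`).

*From partitions to trees and forests.* By an exchange argument, a maximum family of edge-disjoint
forests attains the rank formula for the union of graphic matroids for some partition
(`exists_isForestPacking_card_ge`). Applied to `k` forests, this gives `k` spanning trees; applied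
to families that extend these by one forest `F`, it gives `|E(F)| > (δ - 1) n / δ`
(`exists_trees_and_forest`, `add_mul_card_lt_card_crossing`). This is slightly more than the
required `(δ - 1) (n - 1) / δ`; the surplus comes from the minimum degree, since classes with at most
`δ` vertices have `d(U) ≥ δ ≥ 2 (k + 1)`. A forest with more than `(δ - 1) n / δ` edges has a
component with at least `δ` edges, since otherwise each component has at most `(δ - 1) / δ` times as
many edges as vertices (`exists_component_card_edgeSet_ge`).
-/

namespace SpectralPacking

open SimpleGraph

variable {V : Type*}

/-! ### Forests and their components -/

theorem sum_card_edgeSet_toSimpleGraph [Fintype V] (H : SimpleGraph V)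
    [Fintype H.ConnectedComponent] :
    ∑ C : H.ConnectedComponent, C.toSimpleGraph.edgeSet.ncard = H.edgeSet.ncard := by
  classical
  have key : ∀ (W : Type _) [Fintype W] (K : SimpleGraph W) [DecidableRel K.Adj],
      ∑ v, K.degree v = 2 * K.edgeSet.ncard := by
    intro W _ K _
    rw [K.sum_degrees_eq_twice_card_edges, ← coe_edgeFinset, Set.ncard_coe_finset]
  have hdeg : ∀ (C : H.ConnectedComponent) (v : C.supp),
      C.toSimpleGraph.degree v = H.degree v := by
    intro C v
    rw [← card_neighborFinset_eq_degree, ← card_neighborFinset_eq_degree]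
    refine Finset.card_bij (fun w _ => w.1) ?_ ?_ ?_
    · intro w hw
      rw [mem_neighborFinset] at hw ⊢
      exact hw
    · intro w _ w' _ h
      exact Subtype.ext h
    · intro w hw
      have hw' : H.Adj v w := by simpa using hw
      refine ⟨⟨w, C.mem_supp_of_adj_mem_supp v.2 hw'⟩, ?_, rfl⟩
      rw [mem_neighborFinset]
      exact hw'
  -- Edges are counted by half the degree sum, and degrees do not change in a component.
  have h2 : ∑ C : H.ConnectedComponent, 2 * C.toSimpleGraph.edgeSet.ncard
      = 2 * H.edgeSet.ncard := by
    rw [← key V H, ← Fintype.sum_fiberwise (g := H.connectedComponentMk)]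
    refine Finset.sum_congr rfl fun C _ => ?_
    refine (key _ C.toSimpleGraph).symm.trans ?_
    exact Fintype.sum_congr _ _ fun v => hdeg C v
  rw [← Finset.mul_sum] at h2
  omega

theorem sum_card_supp [Fintype V] (H : SimpleGraph V) [Fintype H.ConnectedComponent] :
    ∑ C : H.ConnectedComponent, C.supp.ncard = Fintype.card V := by
  classical
  have h := Fintype.sum_fiberwise (g := H.connectedComponentMk) (fun _ : V => 1)
  rw [Finset.sum_const, Finset.card_univ, smul_eq_mul, mul_one] at h
  rw [← h]
  refine Finset.sum_congr rfl fun C _ => ?_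
  rw [Finset.sum_const, Finset.card_univ, smul_eq_mul, mul_one, ← Nat.card_coe_set_eq,
    Nat.card_eq_fintype_card]
  exact Fintype.card_congr (Equiv.refl _)

theorem card_edgeSet_toSimpleGraph_add_one [Finite V] {H : SimpleGraph V} (hH : H.IsAcyclic)
    (C : H.ConnectedComponent) : C.toSimpleGraph.edgeSet.ncard + 1 = C.supp.ncard := by
  have h := (isTree_iff_connected_and_card.mp (hH.isTree_connectedComponent C)).2
  rwa [Nat.card_coe_set_eq] at h

theorem card_edgeSet_add_card_connectedComponent [Fintype V] {H : SimpleGraph V}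
    (hH : H.IsAcyclic) :
    H.edgeSet.ncard + Nat.card H.ConnectedComponent = Fintype.card V := by
  classical
  rw [← sum_card_edgeSet_toSimpleGraph H, ← sum_card_supp H, Nat.card_eq_fintype_card,
    ← Finset.card_univ, Finset.card_eq_sum_ones, ← Finset.sum_add_distrib]
  exact Finset.sum_congr rfl fun C _ => card_edgeSet_toSimpleGraph_add_one hH C

theorem isTree_of_card_edgeSet [Fintype V] [Nonempty V] {H : SimpleGraph V} (hH : H.IsAcyclic)
    (h : Fintype.card V ≤ H.edgeSet.ncard + 1) : H.IsTree := by
  have h1 := card_edgeSet_add_card_connectedComponent hH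
  have h2 : Nat.card H.ConnectedComponent ≤ 1 := by omega
  have h3 : Subsingleton H.ConnectedComponent := Finite.card_le_one_iff_subsingleton.mp h2
  refine ⟨⟨fun u v => ?_⟩, hH⟩
  exact ConnectedComponent.exact (Subsingleton.elim _ _)

/-- A forest all of whose components have fewer than `d` edges has at most `(d - 1) n / d` edges,
since a component with `e ≤ d - 1` edges has `e + 1` vertices. -/
theorem exists_component_card_edgeSet_ge [Fintype V] {H : SimpleGraph V} (hH : H.IsAcyclic)
    {d : ℕ} (h : (d - 1) * Fintype.card V < d * H.edgeSet.ncard) :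
    ∃ C : H.ConnectedComponent, d ≤ C.toSimpleGraph.edgeSet.ncard := by
  classical
  by_contra! hC
  refine absurd h (not_lt.mpr ?_)
  rw [← sum_card_edgeSet_toSimpleGraph H, ← sum_card_supp H, Finset.mul_sum, Finset.mul_sum]
  refine Finset.sum_le_sum fun C _ => ?_
  rw [← card_edgeSet_toSimpleGraph_add_one hH C]
  obtain ⟨m, rfl⟩ : ∃ m, d = m + 1 := ⟨d - 1, by have := hC C; omega⟩
  have := hC C
  rw [Nat.add_sub_cancel]
  nlinarith

/-! ### Packing forests -/

/-- A family of pairwise edge-disjoint forests in `G`, each a graph on the whole vertex type. -/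
structure IsForestPacking {ι : Type*} (G : SimpleGraph V) (F : ι → SimpleGraph V) : Prop where
  le : ∀ i, F i ≤ G
  isAcyclic : ∀ i, (F i).IsAcyclic
  disjoint : ∀ i j, i ≠ j → Disjoint (F i).edgeSet (F j).edgeSet

/-- The edges of `G` that lie in no member of the family `F`. -/
def uncovered {ι : Type*} (G : SimpleGraph V) (F : ι → SimpleGraph V) : SimpleGraph V where
  Adj x y := G.Adj x y ∧ ∀ i, ¬ (F i).Adj x y
  symm := ⟨fun _ _ h => ⟨h.1.symm, fun i hi => h.2 i hi.symm⟩⟩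
  loopless := ⟨fun _ h => h.1.ne rfl⟩

/-- `F'` arises from `F` by an exchange: an uncovered edge `xy` enters some `F i`, whose edge `f`
on the path from `x` to `y` leaves. That `f` lies on this path is expressed by `f` separating `x`
from `y`; if `x` and `y` are not even joined in `F i`, any edge `f` of `F i` is allowed. -/
def Exchange {ι : Type*} [DecidableEq ι] (G : SimpleGraph V) (F F' : ι → SimpleGraph V) : Prop :=
  ∃ (i : ι) (x y : V) (f : Sym2 V), (uncovered G F).Adj x y ∧ f ∈ (F i).edgeSet ∧
    ¬ ((F i).deleteEdges {f}).Reachable x y ∧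
    F' = Function.update F i ((F i).deleteEdges {f} ⊔ edge x y)

theorem card_edgeSet_sup_edge [Finite V] {H : SimpleGraph V} {x y : V} (hxy : x ≠ y)
    (h : ¬ H.Adj x y) : (H ⊔ edge x y).edgeSet.ncard = H.edgeSet.ncard + 1 := by
  rw [edgeSet_sup, edgeSet_edge_of_ne hxy, Set.union_singleton,
    Set.ncard_insert_of_notMem (by simpa using h) (Set.toFinite _)]

theorem IsForestPacking.update {ι : Type*} [DecidableEq ι] {G : SimpleGraph V}
    {F : ι → SimpleGraph V} (hF : IsForestPacking G F) {i : ι} {H : SimpleGraph V} {x y : V}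
    (hH : H ≤ F i) (hxy : (uncovered G F).Adj x y) (hr : ¬ H.Reachable x y) :
    IsForestPacking G (Function.update F i (H ⊔ edge x y)) := by
  have hne : x ≠ y := hxy.ne
  have key : ∀ j, j ≠ i → Disjoint (H ⊔ edge x y).edgeSet (F j).edgeSet := by
    intro j hj
    rw [edgeSet_sup, edgeSet_edge_of_ne hne, Set.disjoint_union_left]
    refine ⟨(hF.disjoint i j hj.symm).mono_left (edgeSet_mono hH), ?_⟩
    simpa using hxy.2 j
  refine ⟨fun j => ?_, fun j => ?_, fun j l hjl => ?_⟩
  · rcases eq_or_ne j i with rfl | hj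
    · rw [Function.update_self]
      exact sup_le (hH.trans (hF.le _)) ((G.edge_le_iff).mpr (Or.inr hxy.1))
    · rw [Function.update_of_ne hj]
      exact hF.le j
  · rcases eq_or_ne j i with rfl | hj
    · rw [Function.update_self]
      exact ((hF.isAcyclic _).anti hH).sup_edge_of_not_reachable hr
    · rw [Function.update_of_ne hj]
      exact hF.isAcyclic j
  · rcases eq_or_ne j i with rfl | hj
    · rw [Function.update_self, Function.update_of_ne hjl.symm]
      exact key l hjl.symm
    · rw [Function.update_of_ne hj]
      rcases eq_or_ne l i with rfl | hl
      · rw [Function.update_self]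
        exact (key j hj).symm
      · rw [Function.update_of_ne hl]
        exact hF.disjoint j l hjl

theorem Exchange.isForestPacking {ι : Type*} [DecidableEq ι] {G : SimpleGraph V}
    {F F' : ι → SimpleGraph V} (h : Exchange G F F') (hF : IsForestPacking G F) :
    IsForestPacking G F' := by
  obtain ⟨i, x, y, f, hxy, -, hr, rfl⟩ := h
  exact hF.update (deleteEdges_le _) hxy hr

theorem Exchange.card_edgeSet [Finite V] {ι : Type*} [DecidableEq ι] {G : SimpleGraph V}
    {F F' : ι → SimpleGraph V} (h : Exchange G F F') (j : ι) :
    (F' j).edgeSet.ncard = (F j).edgeSet.ncard := by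
  obtain ⟨i, x, y, f, hxy, hf, hr, rfl⟩ := h
  rcases eq_or_ne j i with rfl | hj
  · rw [Function.update_self, card_edgeSet_sup_edge hxy.ne (fun h => hr h.reachable),
      edgeSet_deleteEdges, Set.ncard_sdiff_singleton_add_one hf (Set.toFinite _)]
  · rw [Function.update_of_ne hj]

/-- The edges of `G` that are left uncovered by some family obtained from `F` by a sequence of
exchanges. -/
def releasable {ι : Type*} [DecidableEq ι] (G : SimpleGraph V) (F : ι → SimpleGraph V) :
    SimpleGraph V where
  Adj x y := ∃ F', Relation.ReflTransGen (Exchange G) F F' ∧ (uncovered G F').Adj x y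
  symm := ⟨fun _ _ ⟨F', h, h'⟩ => ⟨F', h, h'.symm⟩⟩
  loopless := ⟨fun _ ⟨_, _, h⟩ => h.ne rfl⟩

section

variable {ι : Type*} [DecidableEq ι] {G : SimpleGraph V} {F F' : ι → SimpleGraph V}

theorem isForestPacking_of_reflTransGen (hF : IsForestPacking G F)
    (h : Relation.ReflTransGen (Exchange G) F F') : IsForestPacking G F' := by
  induction h with
  | refl => exact hF
  | tail _ h ih => exact h.isForestPacking ih

theorem card_edgeSet_of_reflTransGen [Finite V]
    (h : Relation.ReflTransGen (Exchange G) F F') (j : ι) :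
    (F' j).edgeSet.ncard = (F j).edgeSet.ncard := by
  induction h with
  | refl => rfl
  | tail _ h ih => exact (h.card_edgeSet j).trans ih

/-- Every edge on the path of `F' i` between the ends of an uncovered edge can be released by one
further exchange, so that path consists of releasable edges. -/
theorem reachable_inf_releasable_of_uncovered (hF : IsForestPacking G F)
    (h : Relation.ReflTransGen (Exchange G) F F') {i : ι} {x y : V}
    (hxy : (uncovered G F').Adj x y) (hr : (F' i).Reachable x y) :
    (F' i ⊓ releasable G F).Reachable x y := by
  have hF' := isForestPacking_of_reflTransGen hF h
  obtain ⟨p, hp⟩ := hr.exists_isPath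
  refine ⟨p.transfer _ fun f hf => ?_⟩
  have hfF : f ∈ (F' i).edgeSet := p.edges_subset_edgeSet hf
  have hsep : ¬ ((F' i).deleteEdges {f}).Reachable x y := by
    intro hr'
    obtain ⟨q, hq⟩ := hr'.exists_isPath
    have hq' := (Walk.isPath_mapLe (deleteEdges_le (G := F' i) {f})).mpr hq
    have heq := congrArg Subtype.val
      (((hF'.isAcyclic i).subsingleton_path x y).elim ⟨p, hp⟩ ⟨_, hq'⟩)
    dsimp only at heq
    rw [heq, Walk.edges_mapLe_eq_edges] at hf
    simpa using q.edges_subset_edgeSet hf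
  rw [edgeSet_inf]
  refine ⟨hfF, ?_⟩
  induction f with
  | h u v =>
    refine ⟨_, h.tail ⟨i, x, y, s(u, v), hxy, hfF, hsep, rfl⟩, hF'.le i hfF, fun j => ?_⟩
    rcases eq_or_ne j i with rfl | hj
    · rw [Function.update_self]
      intro hadj
      rw [← mem_edgeSet, edgeSet_sup, edgeSet_edge_of_ne hxy.ne, edgeSet_deleteEdges] at hadj
      rcases hadj with hadj | hadj
      · exact hadj.2 rfl
      · rw [Set.mem_singleton_iff] at hadj
        rw [hadj] at hfF
        exact hxy.2 j hfF
    · rw [Function.update_of_ne hj]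
      exact fun hadj => Set.disjoint_left.mp (hF'.disjoint j i hj) hadj hfF

theorem reachable_of_forall_adj {H K : SimpleGraph V}
    (h : ∀ x y, H.Adj x y → K.Reachable x y) {x y : V} (hr : H.Reachable x y) :
    K.Reachable x y := by
  obtain ⟨p⟩ := hr
  induction p with
  | nil => exact Reachable.rfl
  | cons hadj _ ih => exact (h _ _ hadj).trans ih

/-- If no family obtained from `F` by exchanges can be augmented, then each forest `F i` spans the
graph of releasable edges by its own releasable edges. -/
theorem reachable_inf_releasable (hF : IsForestPacking G F)
    (haug : ∀ F', Relation.ReflTransGen (Exchange G) F F' → ∀ i x y,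
      (uncovered G F').Adj x y → (F' i).Reachable x y)
    (i : ι) {x y : V} (hxy : (releasable G F).Reachable x y) :
    (F i ⊓ releasable G F).Reachable x y := by
  have key : ∀ F', Relation.ReflTransGen (Exchange G) F F' → ∀ u v,
      (F' i ⊓ releasable G F).Reachable u v → (F i ⊓ releasable G F).Reachable u v := by
    intro F' h
    induction h with
    | refl => exact fun _ _ h => h
    | @tail F₁ F₂ h₁ h₂ ih =>
      intro u v huv
      refine ih u v (reachable_of_forall_adj (fun a b hab => ?_) huv)
      obtain ⟨j, x, y, f, hxy, hf, hsep, rfl⟩ := h₂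
      rcases eq_or_ne i j with rfl | hj
      · rw [Function.update_self] at hab
        obtain ⟨hab1, hab2⟩ := hab
        rcases hab1 with hab1 | hab1
        · exact Adj.reachable ⟨deleteEdges_le _ hab1, hab2⟩
        · have hr := reachable_inf_releasable_of_uncovered hF h₁ hxy (haug _ h₁ i x y hxy)
          rw [edge_adj] at hab1
          rcases hab1.1 with ⟨rfl, rfl⟩ | ⟨rfl, rfl⟩
          · exact hr
          · exact hr.symm
      · rw [Function.update_of_ne hj] at hab
        exact hab.reachable
  refine reachable_of_forall_adj (fun a b hab => ?_) hxy
  obtain ⟨F', h, hab⟩ := hab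
  exact key F' h a b (reachable_inf_releasable_of_uncovered hF h hab (haug F' h i a b hab))

end

/-- The edges of `G` whose ends lie in different classes of the partition given by the fibres
of `f`. -/
def crossing {κ : Type*} (G : SimpleGraph V) (f : V → κ) : SimpleGraph V :=
  G ⊓ (⊤ : SimpleGraph κ).comap f

/-- The hard direction of the rank formula for the union of graphic matroids. A packing `F₀` can be
replaced by a packing `F`, no member of which is smaller, that attains equality in
`∑ |E(F i)| ≤ e(P) + |ι| (n - |P|)` for the partition `P` into the components of some graph `R`. -/
theorem exists_isForestPacking_card_ge [Fintype V] {ι : Type*} [Fintype ι] {G : SimpleGraph V}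
    {F₀ : ι → SimpleGraph V} (hF₀ : IsForestPacking G F₀) :
    ∃ F : ι → SimpleGraph V, IsForestPacking G F ∧
      (∀ i, (F₀ i).edgeSet.ncard ≤ (F i).edgeSet.ncard) ∧
      ∃ R : SimpleGraph V, (crossing G R.connectedComponentMk).edgeSet.ncard
          + Fintype.card ι * Fintype.card V ≤
        ∑ i, (F i).edgeSet.ncard + Fintype.card ι * Nat.card R.ConnectedComponent := by
  classical
  -- Exchanges keep the size of every member, so they do not leave the set maximized over.
  obtain ⟨F, ⟨hF, hle⟩, hmax⟩ := Set.exists_max_image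
    {F : ι → SimpleGraph V | IsForestPacking G F ∧
      ∀ i, (F₀ i).edgeSet.ncard ≤ (F i).edgeSet.ncard}
    (fun F => ∑ i, (F i).edgeSet.ncard) (Set.toFinite _) ⟨F₀, hF₀, fun _ => le_rfl⟩
  refine ⟨F, hF, hle, releasable G F, ?_⟩
  have haug : ∀ F', Relation.ReflTransGen (Exchange G) F F' → ∀ i x y,
      (uncovered G F').Adj x y → (F' i).Reachable x y := by
    intro F' h i x y hxy
    by_contra hr
    have hF' := isForestPacking_of_reflTransGen hF h
    have hcard : ∀ j, (F' j).edgeSet.ncard = (F j).edgeSet.ncard :=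
      card_edgeSet_of_reflTransGen h
    have hlt : ∀ j, (F j).edgeSet.ncard + (if j = i then 1 else 0)
        = (Function.update F' i (F' i ⊔ edge x y) j).edgeSet.ncard := by
      intro j
      rcases eq_or_ne j i with rfl | hj
      · rw [Function.update_self, card_edgeSet_sup_edge hxy.ne (hxy.2 j), hcard, if_pos rfl]
      · rw [Function.update_of_ne hj, hcard, if_neg hj, add_zero]
    have := hmax (Function.update F' i (F' i ⊔ edge x y))
      ⟨hF'.update le_rfl hxy hr, fun j => by rw [← hlt]; exact (hle j).trans (Nat.le_add_right _ _)⟩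
    simp only [← hlt, Finset.sum_add_distrib, Finset.sum_ite_eq', Finset.mem_univ, if_true] at this
    omega
  set R := releasable G F with hR
  have hspan : ∀ i, (F i ⊓ R).edgeSet.ncard + Nat.card R.ConnectedComponent = Fintype.card V := by
    intro i
    rw [← card_edgeSet_add_card_connectedComponent ((hF.isAcyclic i).anti
      (inf_le_left : F i ⊓ R ≤ F i))]
    congr 1
    refine Nat.card_congr (Quot.congrRight fun x y => ?_)
    exact ⟨reachable_inf_releasable hF haug i, Reachable.mono inf_le_right⟩
  have hcross : (crossing G R.connectedComponentMk).edgeSet.ncard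
      ≤ ∑ i, (F i \ R).edgeSet.ncard := by
    have hsub : (crossing G R.connectedComponentMk).edgeSet ⊆
        ⋃ i ∈ (Finset.univ : Finset ι), (F i \ R).edgeSet := by
      intro e
      induction e with
      | h x y =>
        rintro ⟨hG, hne⟩
        have hnR : ¬ R.Adj x y := fun h => hne (ConnectedComponent.sound h.reachable)
        have : ¬ (uncovered G F).Adj x y := fun h => hnR ⟨F, .refl, h⟩
        obtain ⟨i, hi⟩ : ∃ i, (F i).Adj x y := by
          by_contra! h
          exact this ⟨hG, h⟩
        simp only [Set.mem_iUnion]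
        exact ⟨i, Finset.mem_univ i, hi, hnR⟩
    exact (Set.ncard_le_ncard hsub (Set.toFinite _)).trans
      (Finset.set_ncard_biUnion_le _ _)
  have hsplit : ∀ i, (F i ⊓ R).edgeSet.ncard + (F i \ R).edgeSet.ncard
      = (F i).edgeSet.ncard := by
    intro i
    rw [edgeSet_inf, edgeSet_sdiff]
    exact Set.ncard_inter_add_ncard_sdiff_eq_ncard _ _ (Set.toFinite _)
  have hsum : ∑ i : ι, ((F i ⊓ R).edgeSet.ncard + Nat.card R.ConnectedComponent)
      = ∑ _i : ι, Fintype.card V := Finset.sum_congr rfl fun i _ => hspan i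
  rw [Finset.sum_add_distrib, Finset.sum_const, Finset.sum_const, Finset.card_univ, smul_eq_mul,
    smul_eq_mul] at hsum
  have hsum' : ∑ i : ι, (F i).edgeSet.ncard
      = ∑ i, (F i ⊓ R).edgeSet.ncard + ∑ i, (F i \ R).edgeSet.ncard := by
    rw [← Finset.sum_add_distrib]
    exact Finset.sum_congr rfl fun i _ => (hsplit i).symm
  omega

/-- Suppose that every partition of the vertices into `s` classes is crossed by at least `k (s - 1)`
edges and by more than `q + (k + 1) s - n - k` edges, where the classes are the components of a
graph `R`. Then there are `k` edge-disjoint spanning trees and a forest, edge-disjoint from them,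
with more than `q` edges. -/
theorem exists_trees_and_forest [Fintype V] [Nonempty V] {G : SimpleGraph V} {k q : ℕ}
    (htree : ∀ R : SimpleGraph V, k * Nat.card R.ConnectedComponent ≤
      (crossing G R.connectedComponentMk).edgeSet.ncard + k)
    (hforest : ∀ R : SimpleGraph V, q + (k + 1) * Nat.card R.ConnectedComponent <
      (crossing G R.connectedComponentMk).edgeSet.ncard + Fintype.card V + k) :
    ∃ (T : Fin k → SimpleGraph V) (F : SimpleGraph V),
      (∀ i, T i ≤ G ∧ (T i).IsTree) ∧
      (∀ i j, i ≠ j → Disjoint (T i).edgeSet (T j).edgeSet) ∧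
      F ≤ G ∧ F.IsAcyclic ∧ (∀ i, Disjoint (T i).edgeSet F.edgeSet) ∧
      q < F.edgeSet.ncard := by
  have hforest_le : ∀ H : SimpleGraph V, H.IsAcyclic → H.edgeSet.ncard + 1 ≤ Fintype.card V := by
    intro H hH
    have h1 := card_edgeSet_add_card_connectedComponent hH
    have h2 : 0 < Nat.card H.ConnectedComponent := Nat.card_pos
    omega
  have h0 : IsForestPacking G (fun _ : Fin k => (⊥ : SimpleGraph V)) :=
    ⟨fun _ => bot_le, fun _ => isAcyclic_bot, fun _ _ _ => by simp⟩
  obtain ⟨T, hT, -, R, hR⟩ := exists_isForestPacking_card_ge h0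
  have hTtree : ∀ i, Fintype.card V ≤ (T i).edgeSet.ncard + 1 := by
    by_contra! hlt
    obtain ⟨i, hi⟩ := hlt
    have hs : ∑ i, ((T i).edgeSet.ncard + 1) < ∑ _i : Fin k, Fintype.card V :=
      Finset.sum_lt_sum (fun j _ => hforest_le _ (hT.isAcyclic j)) ⟨i, Finset.mem_univ i, hi⟩
    rw [Finset.sum_add_distrib] at hs
    simp only [Finset.sum_const, Finset.card_univ, Fintype.card_fin, smul_eq_mul, mul_one] at hs
    rw [Fintype.card_fin] at hR
    have := htree R
    omega
  -- The spanning trees and an empty forest: none of the trees can become smaller, and none can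
  -- become larger, when this family is improved.
  have h1 : IsForestPacking G (fun o : Option (Fin k) => o.elim ⊥ T) := by
    refine ⟨?_, ?_, ?_⟩
    · rintro (_ | i)
      exacts [bot_le, hT.le i]
    · rintro (_ | i)
      exacts [isAcyclic_bot, hT.isAcyclic i]
    · rintro (_ | i) (_ | j) hij
      · simp
      · simp
      · simp
      · exact hT.disjoint i j (by simpa using hij)
  obtain ⟨F, hF, hle, R', hR'⟩ := exists_isForestPacking_card_ge h1
  refine ⟨fun i => F (some i), F none, fun i => ⟨hF.le _, ?_⟩, fun i j hij => ?_, hF.le _,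
    hF.isAcyclic _, fun i => hF.disjoint _ _ (by simp), ?_⟩
  · refine isTree_of_card_edgeSet (hF.isAcyclic _) ?_
    have := hle (some i)
    have := hTtree i
    simp only [Option.elim_some] at *
    omega
  · exact hF.disjoint _ _ (by simpa using hij)
  · rw [Fintype.sum_option, Fintype.card_option, Fintype.card_fin] at hR'
    have hs : ∑ i : Fin k, ((F (some i)).edgeSet.ncard + 1) ≤ ∑ _i : Fin k, Fintype.card V :=
      Finset.sum_le_sum fun j _ => hforest_le _ (hF.isAcyclic _)
    rw [Finset.sum_add_distrib] at hs
    simp only [Finset.sum_const, Finset.card_univ, Fintype.card_fin, smul_eq_mul, mul_one] at hs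
    have := hforest R'
    rw [add_one_mul k (Fintype.card V)] at hR'
    omega

/-! ### Eigenvalue bounds from subspaces of test vectors -/

theorem exists_ne_zero_forall_dotProduct_eq_zero [Fintype V] {m : ℕ} (L : (Fin m → ℝ) →ₗ[ℝ] V → ℝ)
    (v : V → V → ℝ) {S : Finset V} (hS : S.card < m) :
    ∃ x ≠ 0, ∀ j ∈ S, v j ⬝ᵥ L x = 0 := by
  let Φ : (Fin m → ℝ) →ₗ[ℝ] S → ℝ :=
    LinearMap.pi fun j => (dotProductBilin ℝ ℝ (v j)).comp L
  have hker : LinearMap.ker Φ ≠ ⊥ := LinearMap.ker_ne_bot_of_finrank_lt (by simpa using hS)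
  obtain ⟨x, hx, hx0⟩ := (Submodule.ne_bot_iff _).mp hker
  exact ⟨x, hx0, fun j hj => congrFun (LinearMap.mem_ker.mp hx) ⟨j, hj⟩⟩

section CourantFischer

variable [Fintype V] [DecidableEq V] {A : Matrix V V ℝ} (hA : A.IsHermitian)

theorem dotProduct_self_eq_sum_sq (y : V → ℝ) :
    y ⬝ᵥ y = ∑ j, ((hA.eigenvectorBasis j).ofLp ⬝ᵥ y) ^ 2 := by
  have h := hA.eigenvectorBasis.sum_inner_mul_inner (WithLp.toLp 2 y) (WithLp.toLp 2 y)
  simp only [EuclideanSpace.inner_eq_star_dotProduct, star_trivial] at h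
  rw [← h]
  refine Finset.sum_congr rfl fun j _ => ?_
  rw [dotProduct_comm y, sq]

theorem dotProduct_mulVec_eq_sum_eigenvalues (y : V → ℝ) :
    y ⬝ᵥ A.mulVec y
      = ∑ j, hA.eigenvalues j * ((hA.eigenvectorBasis j).ofLp ⬝ᵥ y) ^ 2 := by
  have h := hA.eigenvectorBasis.sum_inner_mul_inner (WithLp.toLp 2 y)
    (WithLp.toLp 2 (A.mulVec y))
  simp only [EuclideanSpace.inner_eq_star_dotProduct, star_trivial] at h
  rw [dotProduct_comm, ← h]
  refine Finset.sum_congr rfl fun j _ => ?_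
  have hsymm : A.mulVec y ⬝ᵥ (hA.eigenvectorBasis j).ofLp
      = hA.eigenvalues j * ((hA.eigenvectorBasis j).ofLp ⬝ᵥ y) := by
    have hT : A.transpose = A := by
      simpa [Matrix.conjTranspose_eq_transpose_of_trivial] using hA.eq
    rw [dotProduct_comm, Matrix.dotProduct_mulVec, ← Matrix.mulVec_transpose, hT,
      hA.mulVec_eigenvectorBasis j, smul_dotProduct, smul_eq_mul]
  rw [hsymm]
  ring

/-- One half of the Courant–Fischer theorem: if the Rayleigh quotient is at least `μ` on an
`m`-dimensional space, here the range of `L`, then so is the `m`-th largest eigenvalue. -/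
theorem le_ithLargestEigenvalue {m : ℕ} (hm : 1 ≤ m) (hmV : m ≤ Fintype.card V)
    (L : (Fin m → ℝ) →ₗ[ℝ] V → ℝ) (hL : ∀ x ≠ 0, L x ≠ 0) {μ : ℝ}
    (h : ∀ x, μ * (L x ⬝ᵥ L x) ≤ L x ⬝ᵥ A.mulVec (L x)) :
    μ ≤ ithLargestEigenvalue hA m := by
  rw [ithLargestEigenvalue, dif_pos ⟨hm, hmV⟩]
  by_contra! hlt
  let e : V ≃ Fin (Fintype.card V) := (Fintype.equivOfCardEq (Fintype.card_fin _)).symm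
  -- Fewer than `m` eigenvalues reach `μ`, so some test vector is orthogonal to their eigenvectors.
  have hS : (Finset.univ.filter fun j => μ ≤ hA.eigenvalues j).card < m := by
    have : (Finset.univ.filter fun j => μ ≤ hA.eigenvalues j).card
        ≤ (Finset.range (m - 1)).card := by
      refine Finset.card_le_card_of_injOn (fun j => (e j).val) (fun j hj => ?_)
        (fun i _ j _ hij => e.injective (Fin.ext hij))
      have hj' : μ ≤ hA.eigenvalues₀ (e j) := (Finset.mem_filter.mp hj).2
      by_contra hge
      have hge' : (⟨m - 1, by omega⟩ : Fin (Fintype.card V)) ≤ e j := by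
        simpa [Fin.le_def] using hge
      exact absurd (hA.eigenvalues₀_antitone hge') (not_le.mpr (hlt.trans_le hj'))
    rw [Finset.card_range] at this
    omega
  obtain ⟨x, hx0, hx⟩ := exists_ne_zero_forall_dotProduct_eq_zero L
    (fun j => (hA.eigenvectorBasis j).ofLp) hS
  have hterm : ∀ j, 0 ≤ (μ - hA.eigenvalues j) * ((hA.eigenvectorBasis j).ofLp ⬝ᵥ L x) ^ 2 := by
    intro j
    by_cases hj : μ ≤ hA.eigenvalues j
    · rw [hx j (by simpa using hj)]
      simp
    · exact mul_nonneg (by linarith) (sq_nonneg _)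
  have hsum : ∑ j, (μ - hA.eigenvalues j) * ((hA.eigenvectorBasis j).ofLp ⬝ᵥ L x) ^ 2 ≤ 0 := by
    simp only [sub_mul, Finset.sum_sub_distrib]
    rw [← dotProduct_mulVec_eq_sum_eigenvalues, ← Finset.mul_sum, ← dotProduct_self_eq_sum_sq]
    linarith [h x]
  have hz := (Finset.sum_eq_zero_iff_of_nonneg fun j _ => hterm j).mp
    (le_antisymm hsum (Finset.sum_nonneg fun j _ => hterm j))
  refine hL x hx0 (dotProduct_self_eq_zero.mp ?_)
  rw [dotProduct_self_eq_sum_sq hA]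
  refine Finset.sum_eq_zero fun j hj => ?_
  by_cases hj' : μ ≤ hA.eigenvalues j
  · rw [hx j (by simpa using hj')]
    simp
  · exact (mul_eq_zero.mp (hz j hj)).resolve_left (by linarith)

/-- The other half of the Courant–Fischer theorem: if the Rayleigh quotient is at most `μ` on an
`m`-dimensional space, then so is the `m`-th smallest eigenvalue. -/
theorem ithLargestEigenvalue_le {m : ℕ} (hm : 1 ≤ m) (hmV : m ≤ Fintype.card V)
    (L : (Fin m → ℝ) →ₗ[ℝ] V → ℝ) (hL : ∀ x ≠ 0, L x ≠ 0) {μ : ℝ}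
    (h : ∀ x, L x ⬝ᵥ A.mulVec (L x) ≤ μ * (L x ⬝ᵥ L x)) :
    ithLargestEigenvalue hA (Fintype.card V + 1 - m) ≤ μ := by
  rw [ithLargestEigenvalue, dif_pos ⟨by omega, by omega⟩]
  by_contra! hlt
  let e : V ≃ Fin (Fintype.card V) := (Fintype.equivOfCardEq (Fintype.card_fin _)).symm
  have hS : (Finset.univ.filter fun j => hA.eigenvalues j ≤ μ).card < m := by
    have : (Finset.univ.filter fun j => hA.eigenvalues j ≤ μ).card
        ≤ (Finset.Ico (Fintype.card V + 1 - m) (Fintype.card V)).card := by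
      refine Finset.card_le_card_of_injOn (fun j => (e j).val) (fun j hj => ?_)
        (fun i _ j _ hij => e.injective (Fin.ext hij))
      have hj' : hA.eigenvalues₀ (e j) ≤ μ := (Finset.mem_filter.mp hj).2
      by_contra hge
      have hge' : e j ≤ (⟨Fintype.card V + 1 - m - 1, by omega⟩ : Fin (Fintype.card V)) := by
        have := (e j).2
        simp only [Finset.coe_Ico, Set.mem_Ico, not_and, not_lt] at hge
        rw [Fin.le_def]
        dsimp only
        omega
      exact absurd (hA.eigenvalues₀_antitone hge') (not_le.mpr (hj'.trans_lt hlt))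
    rw [Nat.card_Ico] at this
    omega
  obtain ⟨x, hx0, hx⟩ := exists_ne_zero_forall_dotProduct_eq_zero L
    (fun j => (hA.eigenvectorBasis j).ofLp) hS
  have hterm : ∀ j, 0 ≤ (hA.eigenvalues j - μ) * ((hA.eigenvectorBasis j).ofLp ⬝ᵥ L x) ^ 2 := by
    intro j
    by_cases hj : hA.eigenvalues j ≤ μ
    · rw [hx j (by simpa using hj)]
      simp
    · exact mul_nonneg (by linarith) (sq_nonneg _)
  have hsum : ∑ j, (hA.eigenvalues j - μ) * ((hA.eigenvectorBasis j).ofLp ⬝ᵥ L x) ^ 2 ≤ 0 := by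
    simp only [sub_mul, Finset.sum_sub_distrib]
    rw [← dotProduct_mulVec_eq_sum_eigenvalues, ← Finset.mul_sum, ← dotProduct_self_eq_sum_sq]
    linarith [h x]
  have hz := (Finset.sum_eq_zero_iff_of_nonneg fun j _ => hterm j).mp
    (le_antisymm hsum (Finset.sum_nonneg fun j _ => hterm j))
  refine hL x hx0 (dotProduct_self_eq_zero.mp ?_)
  rw [dotProduct_self_eq_sum_sq hA]
  refine Finset.sum_eq_zero fun j hj => ?_
  by_cases hj' : hA.eigenvalues j ≤ μ
  · rw [hx j (by simpa using hj')]
    simp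
  · exact (mul_eq_zero.mp (hz j hj)).resolve_left (by linarith)

end CourantFischer

/-! ### Edge boundaries and the quadratic form of `a D + b A` -/

theorem dotProduct_comp_self [Fintype V] {κ : Type*} [Fintype κ] [DecidableEq κ]
    (f : V → κ) (X : κ → ℝ) :
    (X ∘ f) ⬝ᵥ (X ∘ f) = ∑ o, X o ^ 2 * (Finset.univ.filter (f · = o)).card := by
  rw [dotProduct, ← Finset.sum_fiberwise (g := f)]
  refine Finset.sum_congr rfl fun o _ => ?_
  rw [Finset.sum_congr rfl (g := fun _ => X o ^ 2)]
  · rw [Finset.sum_const, nsmul_eq_mul, mul_comm]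
  · intro v hv
    rw [Function.comp_apply, (Finset.mem_filter.mp hv).2, sq]

section Boundary

variable [Fintype V] [DecidableEq V] (G : SimpleGraph V) [DecidableRel G.Adj]

theorem edgesBetween_compl_eq_sum (U : Finset V) :
    (edgesBetween G U (Finset.univ \ U) : ℝ)
      = ∑ u, ∑ v, if G.Adj u v ∧ u ∈ U ∧ v ∉ U then (1 : ℝ) else 0 := by
  rw [edgesBetween, ← Fintype.sum_prod_type'
    (f := fun u v => if G.Adj u v ∧ u ∈ U ∧ v ∉ U then (1 : ℝ) else 0),
    Finset.sum_boole]
  congr 2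
  ext ⟨u, v⟩
  simp [mem_interedges_iff]
  tauto

variable {κ : Type*} [Fintype κ] [DecidableEq κ]

/-- The ordered pairs `(u, v)` of adjacent vertices in different fibres of `f`, weighted by the fibre
of `u`, are counted by the edge boundaries of the fibres. -/
theorem sum_ite_crossing (f : V → κ) (w : κ → ℝ) :
    (∑ u, ∑ v, if G.Adj u v ∧ f u ≠ f v then w (f u) else 0)
      = ∑ o, w o * edgesBetween G (Finset.univ.filter (f · = o))
          (Finset.univ \ Finset.univ.filter (f · = o)) := by
  simp only [edgesBetween_compl_eq_sum, Finset.mul_sum]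
  symm
  rw [Finset.sum_comm]
  refine Finset.sum_congr rfl fun u _ => ?_
  rw [Finset.sum_comm]
  refine Finset.sum_congr rfl fun v _ => ?_
  rw [Finset.sum_eq_single (f u)]
  · simp [eq_comm]
  · intro o _ ho
    simp [ho.symm]
  · simp

theorem two_mul_card_crossing (f : V → κ) :
    2 * ((crossing G f).edgeSet.ncard : ℝ) = ∑ o,
      (edgesBetween G (Finset.univ.filter (f · = o))
          (Finset.univ \ Finset.univ.filter (f · = o)) : ℝ) := by
  classical
  have h := sum_ite_crossing G f 1
  simp only [Pi.one_apply, one_mul] at h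
  rw [← h, ← coe_edgeFinset, Set.ncard_coe_finset]
  have h2 := (crossing G f).sum_degrees_eq_twice_card_edges
  have h3 := congrArg (Nat.cast (R := ℝ)) h2
  push_cast at h3
  rw [← h3]
  refine Finset.sum_congr rfl fun u _ => ?_
  rw [Finset.sum_boole, ← card_neighborFinset_eq_degree]
  congr 2
  ext v
  rw [Finset.mem_filter_univ, mem_neighborFinset]
  rfl

/-- For a vector constant on the fibres of `f`, only crossing edges `uv` contribute to the Laplacian
form, each at most `2 X (f u) ^ 2 + 2 X (f v) ^ 2`. -/
theorem dotProduct_lapMatrix_comp_le (f : V → κ) (X : κ → ℝ) :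
    (X ∘ f) ⬝ᵥ (G.lapMatrix ℝ).mulVec (X ∘ f)
      ≤ 2 * ∑ o, X o ^ 2 * edgesBetween G (Finset.univ.filter (f · = o))
          (Finset.univ \ Finset.univ.filter (f · = o)) := by
  rw [← Matrix.toLinearMap₂'_apply', lapMatrix_toLinearMap₂',
    ← sum_ite_crossing G f (fun o => X o ^ 2)]
  have hsymm : (∑ u, ∑ v, if G.Adj u v ∧ f u ≠ f v then X (f v) ^ 2 else 0)
      = ∑ u, ∑ v, if G.Adj u v ∧ f u ≠ f v then X (f u) ^ 2 else 0 := by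
    rw [Finset.sum_comm]
    refine Finset.sum_congr rfl fun u _ => Finset.sum_congr rfl fun v _ => ?_
    simp only [G.adj_comm v u, ne_comm (a := f v)]
  have hle : (∑ u, ∑ v, if G.Adj u v then ((X ∘ f) u - (X ∘ f) v) ^ 2 else 0)
      ≤ ∑ u, ∑ v, (2 * (if G.Adj u v ∧ f u ≠ f v then X (f u) ^ 2 else 0)
          + 2 * (if G.Adj u v ∧ f u ≠ f v then X (f v) ^ 2 else 0)) := by
    refine Finset.sum_le_sum fun u _ => Finset.sum_le_sum fun v _ => ?_
    by_cases hadj : G.Adj u v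
    · by_cases hf : f u = f v
      · simp [hf]
      · simp only [hadj, hf, Function.comp_apply, ne_eq, not_false_eq_true, and_self, if_true]
        nlinarith [sq_nonneg (X (f u) + X (f v))]
    · simp [hadj]
  simp only [Finset.sum_add_distrib, ← Finset.mul_sum] at hle
  rw [hsymm] at hle
  linarith

/-- The quadratic form of the decomposition `a D + b A = (a + b) D - b L`, with `L = D - A` the
Laplacian. -/
theorem dotProduct_degAddSmulAdj_mulVec (a b : ℝ) (y : V → ℝ) :
    y ⬝ᵥ (degAddSmulAdj G a b).mulVec y = (a + b) * (y ⬝ᵥ (G.degMatrix ℝ).mulVec y)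
      - b * (y ⬝ᵥ (G.lapMatrix ℝ).mulVec y) := by
  simp only [degAddSmulAdj, lapMatrix, Matrix.add_mulVec, Matrix.sub_mulVec, Matrix.smul_mulVec,
    dotProduct_add, dotProduct_sub, dotProduct_smul, smul_eq_mul]
  ring

theorem minDegree_mul_dotProduct_le (y : V → ℝ) :
    G.minDegree * (y ⬝ᵥ y) ≤ y ⬝ᵥ (G.degMatrix ℝ).mulVec y := by
  rw [dotProduct_mulVec_degMatrix, dotProduct, Finset.mul_sum]
  refine Finset.sum_le_sum fun v _ => ?_
  have : (G.minDegree : ℝ) ≤ G.degree v := by exact_mod_cast G.minDegree_le_degree v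
  nlinarith [mul_self_nonneg (y v)]

/-- A non-empty set with fewer than `minDegree` outgoing edges has more than `minDegree` vertices:
each of its `s` vertices has at least `minDegree + 1 - s` neighbours outside. -/
theorem minDegree_lt_card_of_edgesBetween_lt {U : Finset V} (hU : U.Nonempty)
    (h : edgesBetween G U (Finset.univ \ U) < G.minDegree) : G.minDegree < U.card := by
  by_contra! hle
  have hcount : U.card * (G.minDegree + 1 - U.card) ≤ edgesBetween G U (Finset.univ \ U) := by
    have hfib : edgesBetween G U (Finset.univ \ U)
        = ∑ u ∈ U, (G.neighborFinset u \ U).card := by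
      rw [edgesBetween, Finset.card_eq_sum_card_fiberwise (f := Prod.fst) (t := U)
        (fun e he => ((mem_interedges_iff G).mp he).1)]
      refine Finset.sum_congr rfl fun u hu => ?_
      refine Finset.card_bij' (fun e _ => e.2) (fun v _ => (u, v)) ?_ ?_ ?_ ?_
      · rintro ⟨x, y⟩ he
        simp only [Finset.mem_filter, mem_interedges_iff] at he
        obtain ⟨⟨-, hy, hadj⟩, rfl⟩ := he
        simpa [hadj] using hy
      · intro v hv
        simpa [mem_interedges_iff, hu, and_comm] using hv
      · rintro ⟨x, y⟩ he
        rw [← (Finset.mem_filter.mp he).2]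
      · intro v _
        rfl
    rw [hfib, ← smul_eq_mul, ← Finset.sum_const]
    refine Finset.sum_le_sum fun u hu => ?_
    have h1 : (G.neighborFinset u).card ≤ (G.neighborFinset u \ U).card + (U.erase u).card := by
      rw [← Finset.card_sdiff_add_card_inter (G.neighborFinset u) U]
      refine Nat.add_le_add_left (Finset.card_le_card fun v hv => ?_) _
      rw [Finset.mem_inter, mem_neighborFinset] at hv
      exact Finset.mem_erase.mpr ⟨hv.1.ne', hv.2⟩
    rw [card_neighborFinset_eq_degree, Finset.card_erase_of_mem hu] at h1
    have := G.minDegree_le_degree u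
    have := Finset.card_pos.mpr hU
    omega
  have hpos := Finset.card_pos.mpr hU
  obtain ⟨t, ht⟩ := Nat.exists_eq_add_of_le hle
  obtain ⟨s, hs⟩ := Nat.exists_eq_add_of_le hpos
  have : G.minDegree + 1 - U.card = t + 1 := by omega
  rw [this] at hcount
  have hst : U.card * (t + 1) < U.card + t := by omega
  rw [hs] at hst
  nlinarith [Nat.zero_le (s * t)]

end Boundary

section Eigenvalue

variable [Fintype V] [DecidableEq V] (G : SimpleGraph V) [DecidableRel G.Adj]

/-- Pairwise disjoint vertex sets that are large and have small edge boundary yield a space of test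
vectors, spanned by their indicator functions, on which the Laplacian form is small compared
with the norm. -/
theorem exists_testVectors {m : ℕ} {U : Fin m → Finset V}
    (hdisj : ∀ i j, i ≠ j → Disjoint (U i) (U j))
    {N D : ℝ} (hN : 0 < N) (hD : 0 ≤ D) (hcard : ∀ i, N ≤ (U i).card)
    (hbd : ∀ i, (edgesBetween G (U i) (Finset.univ \ U i) : ℝ) ≤ D) :
    ∃ L : (Fin m → ℝ) →ₗ[ℝ] V → ℝ, (∀ x ≠ 0, L x ≠ 0) ∧
      ∀ x, L x ⬝ᵥ (G.lapMatrix ℝ).mulVec (L x) ≤ 2 * D / N * (L x ⬝ᵥ L x) := by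
  -- The fibre of `f` over `some i` is `U i`; the vertices in none of the sets go to `none`.
  let f : V → Option (Fin m) := fun v => if h : ∃ i, v ∈ U i then some h.choose else none
  have hf : ∀ i v, f v = some i ↔ v ∈ U i := by
    intro i v
    by_cases h : ∃ i, v ∈ U i
    · have hc := h.choose_spec
      simp only [f, dif_pos h, Option.some_inj]
      refine ⟨fun hi => hi ▸ hc, fun hi => ?_⟩
      by_contra hne
      exact Finset.disjoint_left.mp (hdisj _ _ hne) hc hi
    · simp only [f, dif_neg h]
      exact ⟨fun h' => by simp at h', fun h' => absurd ⟨i, h'⟩ h⟩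
  have hfib : ∀ i, Finset.univ.filter (f · = some i) = U i := by
    intro i
    ext v
    simp [hf]
  let X : (Fin m → ℝ) → Option (Fin m) → ℝ := fun x o => o.elim 0 x
  let L : (Fin m → ℝ) →ₗ[ℝ] V → ℝ :=
    { toFun := fun x => X x ∘ f
      map_add' := fun x y => by
        ext v
        cases h : f v <;> simp [X, h]
      map_smul' := fun r x => by
        ext v
        cases h : f v <;> simp [X, h] }
  refine ⟨L, fun x hx hLx => hx ?_, fun x => ?_⟩
  · ext i
    have hne : (U i).Nonempty := by
      rw [← Finset.card_pos]
      exact_mod_cast hN.trans_le (hcard i)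
    obtain ⟨v, hv⟩ := hne
    have := congrFun hLx v
    simpa [L, X, (hf i v).mpr hv] using this
  · change (X x ∘ f) ⬝ᵥ (G.lapMatrix ℝ).mulVec (X x ∘ f) ≤ 2 * D / N * ((X x ∘ f) ⬝ᵥ (X x ∘ f))
    refine (dotProduct_lapMatrix_comp_le G f (X x)).trans ?_
    rw [dotProduct_comp_self, Fintype.sum_option, Fintype.sum_option]
    simp only [hfib, X, Option.elim_none, Option.elim_some, ne_eq, OfNat.ofNat_ne_zero,
      not_false_eq_true, zero_pow, zero_mul, zero_add, Finset.mul_sum]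
    refine Finset.sum_le_sum fun i _ => ?_
    have h1 : D ≤ D / N * (U i).card := by
      rw [div_mul_eq_mul_div, le_div_iff₀ hN]
      exact mul_le_mul_of_nonneg_left (hcard i) hD
    have h2 := mul_le_mul_of_nonneg_left ((hbd i).trans h1) (sq_nonneg (x i))
    calc 2 * (x i ^ 2 * _) ≤ 2 * (x i ^ 2 * (D / N * (U i).card)) := by linarith
      _ = 2 * D / N * (x i ^ 2 * (U i).card) := by ring

variable {G} {m : ℕ} {U : Fin m → Finset V} {N D a b : ℝ}

theorem le_lam₂ (hm : 1 ≤ m) (hmV : m ≤ Fintype.card V)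
    (hdisj : ∀ i j, i ≠ j → Disjoint (U i) (U j))
    (hN : 0 < N) (hD : 0 ≤ D) (hcard : ∀ i, N ≤ (U i).card)
    (hbd : ∀ i, (edgesBetween G (U i) (Finset.univ \ U i) : ℝ) ≤ D)
    (hb : 0 ≤ b) (hab : 0 ≤ a + b) :
    (a + b) * G.minDegree - b * (2 * D / N) ≤ lam₂ G a b m := by
  obtain ⟨L, hL, hform⟩ := exists_testVectors G hdisj hN hD hcard hbd
  refine le_ithLargestEigenvalue _ hm hmV L hL fun x => ?_
  rw [dotProduct_degAddSmulAdj_mulVec]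
  have h1 := mul_le_mul_of_nonneg_left (minDegree_mul_dotProduct_le G (L x)) hab
  have h2 := mul_le_mul_of_nonneg_left (hform x) hb
  linarith

theorem lam₂_le (hm : 1 ≤ m) (hmV : m ≤ Fintype.card V)
    (hdisj : ∀ i j, i ≠ j → Disjoint (U i) (U j))
    (hN : 0 < N) (hD : 0 ≤ D) (hcard : ∀ i, N ≤ (U i).card)
    (hbd : ∀ i, (edgesBetween G (U i) (Finset.univ \ U i) : ℝ) ≤ D)
    (hb : b ≤ 0) (hab : a + b ≤ 0) :
    lam₂ G a b (Fintype.card V + 1 - m) ≤ (a + b) * G.minDegree - b * (2 * D / N) := by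
  obtain ⟨L, hL, hform⟩ := exists_testVectors G hdisj hN hD hcard hbd
  refine ithLargestEigenvalue_le _ hm hmV L hL fun x => ?_
  rw [dotProduct_degAddSmulAdj_mulVec]
  have h1 := mul_le_mul_of_nonpos_left (minDegree_mul_dotProduct_le G (L x)) hab
  have h2 := mul_le_mul_of_nonpos_left (hform x) hb
  linarith

end Eigenvalue

/-! ### Edge connectivity and the number of edges crossing a partition -/

theorem card_add_card_fiber_le [Fintype V] {κ : Type*} [Fintype κ] [DecidableEq κ]
    {f : V → κ} (hf : f.Surjective) (o : κ) :
    Fintype.card κ + (Finset.univ.filter (f · = o)).card ≤ Fintype.card V + 1 := by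
  have hle : ∑ o', (if o' = o then (Finset.univ.filter (f · = o)).card else 1)
      ≤ ∑ o', (Finset.univ.filter (f · = o')).card := by
    refine Finset.sum_le_sum fun o' _ => ?_
    split_ifs with h
    · rw [h]
    · obtain ⟨v, hv⟩ := hf o'
      exact Finset.card_pos.mpr ⟨v, by simpa using hv⟩
  rw [← Finset.card_eq_sum_card_fiberwise (fun _ _ => Finset.mem_univ _), Finset.card_univ,
    ← Finset.add_sum_erase _ _ (Finset.mem_univ o), if_pos rfl,
    Finset.sum_congr rfl (g := fun _ => 1) fun o' ho' => if_neg (Finset.ne_of_mem_erase ho'),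
    ← Finset.card_eq_sum_ones, Finset.card_erase_of_mem (Finset.mem_univ o),
    Finset.card_univ] at hle
  have : 0 < Fintype.card κ := Fintype.card_pos_iff.mpr ⟨o⟩
  omega

section

variable [Fintype V] [DecidableEq V] (G : SimpleGraph V) [DecidableRel G.Adj]

theorem edgeConnectivity_le_edgesBetween {U : Finset V} (hne : U.Nonempty)
    (huniv : U ≠ Finset.univ) :
    edgeConnectivity G ≤ edgesBetween G U (Finset.univ \ U) := by
  let X : Finset (Sym2 V) :=
    (G.interedges U (Finset.univ \ U)).image fun e => s(e.1, e.2)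
  refine le_trans (Nat.sInf_le (m := X.card) ⟨(X : Set (Sym2 V)), ?_, Set.ncard_coe_finset X, ?_⟩)
    Finset.card_image_le
  · intro e he
    obtain ⟨p, hp, rfl⟩ := Finset.mem_image.mp he
    exact ((mem_interedges_iff G).mp hp).2.2
  · intro hconn
    obtain ⟨x, hx⟩ := hne
    obtain ⟨y, hy⟩ : ∃ y, y ∉ U := by
      by_contra! h
      exact huniv (Finset.eq_univ_iff_forall.mpr h)
    obtain ⟨p⟩ := hconn.preconnected x y
    obtain ⟨d, -, hd1, hd2⟩ := p.exists_boundary_dart (U : Set V) hx hy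
    have hadj := d.adj
    rw [deleteEdges_adj] at hadj
    refine hadj.2 (Finset.mem_image.mpr ⟨(d.fst, d.snd), ?_, rfl⟩)
    rw [mem_interedges_iff]
    exact ⟨hd1, by simpa using hd2, hadj.1⟩

/-- An edge leaving the complement of `A ∪ B` enters `A` or `B`. -/
theorem edgesBetween_sdiff_union_le (A B : Finset V) :
    edgesBetween G (Finset.univ \ (A ∪ B)) (Finset.univ \ (Finset.univ \ (A ∪ B)))
      ≤ edgesBetween G A (Finset.univ \ A) + edgesBetween G B (Finset.univ \ B) := by
  refine le_trans ?_ (Finset.card_union_le _ _)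
  refine Finset.card_le_card_of_injOn Prod.swap ?_ Prod.swap_injective.injOn
  rintro ⟨x, y⟩ he
  simp only [Finset.mem_coe, mem_interedges_iff, Finset.mem_sdiff, Finset.mem_univ, true_and,
    Finset.coe_union, Set.mem_union, Finset.mem_union, Prod.swap_prod_mk, not_or] at he ⊢
  obtain ⟨⟨hxA, hxB⟩, hy, hadj⟩ := he
  have hy' : y ∈ A ∨ y ∈ B := by tauto
  exact hy'.imp (fun hy => ⟨hy, hxA, hadj.symm⟩) (fun hy => ⟨hy, hxB, hadj.symm⟩)

variable {G}

/-- The complement of the union of the two minimum edge cuts given by `InClass 1` is a third set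
with at most `2 κ'` outgoing edges, so the edge connectivity is at least `c` as soon as there are
no three disjoint sets with fewer than `2 c` outgoing edges. -/
theorem le_edgeConnectivity_of_inClass (hG : InClass 1 G) {c : ℝ} (hc : 0 < c)
    (hthree : ∀ U : Fin 3 → Finset V, (∀ i j, i ≠ j → Disjoint (U i) (U j)) →
      (∀ i, (U i).Nonempty) →
      ∃ i, 2 * c ≤ (edgesBetween G (U i) (Finset.univ \ U i) : ℝ)) :
    c ≤ edgeConnectivity G := by
  obtain ⟨W, hW, hdisj, hrest, hcut⟩ := hG
  by_contra! hlt
  have hunion : (Finset.univ : Finset (Fin (1 + 1))).biUnion W = W 0 ∪ W 1 := by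
    ext v
    simp [Fin.exists_fin_two]
  rw [hunion] at hrest
  have h01 : Disjoint (W 0) (W 1) := hdisj 0 1 (by decide)
  have h0 : Disjoint (W 0) (Finset.univ \ (W 0 ∪ W 1)) :=
    (Finset.disjoint_sdiff).mono_left Finset.subset_union_left
  have h1 : Disjoint (W 1) (Finset.univ \ (W 0 ∪ W 1)) :=
    (Finset.disjoint_sdiff).mono_left Finset.subset_union_right
  obtain ⟨i, hi⟩ := hthree ![W 0, W 1, Finset.univ \ (W 0 ∪ W 1)] (by
    intro i j hij
    fin_cases i <;> fin_cases j <;>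
      first | exact absurd rfl hij | assumption | (apply Disjoint.symm; assumption)) (by
    intro i
    fin_cases i
    exacts [(hW 0).1, (hW 1).1, hrest])
  have hthird : (edgesBetween G (Finset.univ \ (W 0 ∪ W 1))
      (Finset.univ \ (Finset.univ \ (W 0 ∪ W 1))) : ℝ) ≤ 2 * edgeConnectivity G := by
    have := edgesBetween_sdiff_union_le G (W 0) (W 1)
    rw [← hcut 0, ← hcut 1] at this
    rw [two_mul]
    exact_mod_cast this
  have c0 : (edgesBetween G (W 0) (Finset.univ \ W 0) : ℝ) = edgeConnectivity G := by
    rw [hcut 0]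
  have c1 : (edgesBetween G (W 1) (Finset.univ \ W 1) : ℝ) = edgeConnectivity G := by
    rw [hcut 1]
  fin_cases i
  · change 2 * c ≤ (edgesBetween G (W 0) (Finset.univ \ W 0) : ℝ) at hi
    linarith
  · change 2 * c ≤ (edgesBetween G (W 1) (Finset.univ \ W 1) : ℝ) at hi
    linarith
  · change 2 * c ≤ (edgesBetween G (Finset.univ \ (W 0 ∪ W 1))
      (Finset.univ \ (Finset.univ \ (W 0 ∪ W 1))) : ℝ) at hi
    linarith

variable {κ : Type*} [Fintype κ] [DecidableEq κ] {f : V → κ}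

/-- All but at most two of the `s` classes have at least `2 c` outgoing edges, and those two have at
least `c`; the outgoing edges count every crossing edge twice. -/
theorem mul_card_sub_one_le_card_crossing (hf : f.Surjective) {c : ℝ} (hc : 0 < c)
    (hconn : c ≤ edgeConnectivity G)
    (hthree : ∀ U : Fin 3 → Finset V, (∀ i j, i ≠ j → Disjoint (U i) (U j)) →
      (∀ i, (U i).Nonempty) →
      ∃ i, 2 * c ≤ (edgesBetween G (U i) (Finset.univ \ U i) : ℝ)) :
    c * (Fintype.card κ - 1) ≤ (crossing G f).edgeSet.ncard := by
  let d : κ → ℝ := fun o => edgesBetween G (Finset.univ.filter (f · = o))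
    (Finset.univ \ Finset.univ.filter (f · = o))
  have hne : ∀ o, (Finset.univ.filter (f · = o)).Nonempty := fun o => by
    obtain ⟨v, hv⟩ := hf o
    exact ⟨v, by simpa using hv⟩
  rcases subsingleton_or_nontrivial κ with hκ | hκ
  · have : (Fintype.card κ : ℝ) ≤ 1 := by
      exact_mod_cast Fintype.card_le_one_iff_subsingleton.mpr hκ
    exact (mul_nonpos_of_nonneg_of_nonpos hc.le (by linarith)).trans (Nat.cast_nonneg _)
  have hd : ∀ o, c ≤ d o := by
    intro o
    obtain ⟨o', ho'⟩ := exists_ne o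
    obtain ⟨v, hv⟩ := hf o'
    have huniv : Finset.univ.filter (f · = o) ≠ Finset.univ := fun h => by
      have := Finset.mem_univ v
      rw [← h, Finset.mem_filter_univ, hv] at this
      exact ho' this
    exact hconn.trans (Nat.cast_le.mpr (edgeConnectivity_le_edgesBetween G (hne o) huniv))
  have hS : (Finset.univ.filter fun o => d o < 2 * c).card ≤ 2 := by
    by_contra! h3
    obtain ⟨o₁, o₂, o₃, h₁, h₂, h₃, h₁₂, h₁₃, h₂₃⟩ := Finset.two_lt_card_iff.mp h3
    have hdj : ∀ o o' : κ, o ≠ o' →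
        Disjoint (Finset.univ.filter (f · = o)) (Finset.univ.filter (f · = o')) := by
      intro o o' hoo
      exact Finset.disjoint_filter.mpr fun v _ hv hv' => hoo (hv.symm.trans hv')
    have hinj : Function.Injective ![o₁, o₂, o₃] := by
      intro i j hij
      fin_cases i <;> fin_cases j <;> simp_all
    obtain ⟨i, hi⟩ := hthree (fun i => Finset.univ.filter (f · = ![o₁, o₂, o₃] i))
      (fun i j hij => hdj _ _ (hinj.ne hij)) (fun i => hne _)
    have hmem : ![o₁, o₂, o₃] i ∈ Finset.univ.filter fun o => d o < 2 * c := by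
      fin_cases i <;> assumption
    exact absurd hi (not_le.mpr (Finset.mem_filter.mp hmem).2)
  have hsum : ∑ o, (2 * c - if d o < 2 * c then c else 0) ≤ ∑ o, d o := by
    refine Finset.sum_le_sum fun o _ => ?_
    have := hd o
    split_ifs with h
    · linarith
    · linarith
  rw [Finset.sum_sub_distrib, Finset.sum_const, Finset.card_univ, nsmul_eq_mul,
    ← Finset.sum_filter, Finset.sum_const, nsmul_eq_mul] at hsum
  have hS' : ((Finset.univ.filter fun o => d o < 2 * c).card : ℝ) ≤ 2 := by exact_mod_cast hS
  have hcross := two_mul_card_crossing G f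
  change _ = ∑ o, d o at hcross
  nlinarith [mul_le_mul_of_nonneg_right hS' hc.le]

/-- Classes with at most `minDegree` vertices have at least `minDegree` outgoing edges each. -/
theorem minDegree_mul_card_le_card_crossing (hf : f.Surjective)
    (hsmall : ∀ o, (Finset.univ.filter (f · = o)).card ≤ G.minDegree) :
    (G.minDegree : ℝ) * Fintype.card κ ≤ 2 * ((crossing G f).edgeSet.ncard : ℝ) := by
  rw [two_mul_card_crossing, mul_comm, ← nsmul_eq_mul, ← Finset.card_univ, ← Finset.sum_const]
  refine Finset.sum_le_sum fun o _ => ?_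
  obtain ⟨v, hv⟩ := hf o
  by_contra! hlt
  exact absurd (minDegree_lt_card_of_edgesBetween_lt G ⟨v, by simpa using hv⟩
    (by exact_mod_cast hlt)) (not_lt.mpr (hsmall o))

/-- The lower bound on `e(P)` for which the packing theorem yields a forest with more than
`(δ - 1) n / δ` edges. If all classes have at most `δ` vertices, each has at least `δ ≥ 2 (k + 1)`
outgoing edges; otherwise `n - s ≥ δ`, and `e(P) ≥ (k + (δ - 1) / δ) (s - 1)` suffices. -/
theorem add_mul_card_lt_card_crossing [Nonempty V] (hf : f.Surjective) {k : ℕ}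
    (hk : 2 * k + 2 ≤ G.minDegree)
    (hcross : ((k : ℝ) + ((G.minDegree : ℝ) - 1) / G.minDegree) * (Fintype.card κ - 1)
      ≤ (crossing G f).edgeSet.ncard) :
    (G.minDegree - 1) * Fintype.card V / G.minDegree + (k + 1) * Fintype.card κ
      < (crossing G f).edgeSet.ncard + Fintype.card V + k := by
  have hδ : (2 * k + 2 : ℝ) ≤ G.minDegree := by exact_mod_cast hk
  set δ : ℕ := G.minDegree with hδdef
  set n := Fintype.card V
  set s := Fintype.card κ
  have hδ0 : (0 : ℝ) < δ := by linarith [Nat.cast_nonneg (α := ℝ) k]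
  have hn : (0 : ℝ) < n := by exact_mod_cast Fintype.card_pos
  have hq : (((δ - 1) * n / δ : ℕ) : ℝ) ≤ n - n / δ := by
    refine Nat.cast_div_le.trans (le_of_eq ?_)
    rw [Nat.cast_mul, Nat.cast_sub (by omega), Nat.cast_one]
    field_simp
  suffices h : (k + 1 : ℝ) * s < (crossing G f).edgeSet.ncard + n / δ + k by
    have : (((δ - 1) * n / δ : ℕ) : ℝ) + (k + 1) * s
        < (crossing G f).edgeSet.ncard + n + k := by linarith
    exact_mod_cast this
  by_cases hsmall : ∀ o, (Finset.univ.filter (f · = o)).card ≤ δ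
  · have h1 := minDegree_mul_card_le_card_crossing hf hsmall
    have h2 := mul_le_mul_of_nonneg_right hδ (Nat.cast_nonneg (α := ℝ) s)
    have h3 : (0 : ℝ) < n / δ := by positivity
    have h4 : (0 : ℝ) ≤ k := Nat.cast_nonneg k
    rw [← hδdef] at h1
    linarith
  · push Not at hsmall
    obtain ⟨o, ho⟩ := hsmall
    have h1 := card_add_card_fiber_le hf o
    have h2 : (s : ℝ) + δ ≤ n := by
      have : s + δ ≤ n := by omega
      exact_mod_cast this
    have h3 : ((s : ℝ) + δ) / δ ≤ n / δ := by gcongr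
    have h4 : ((s : ℝ) + δ) / δ = s / δ + 1 := by field_simp
    have h5 : ((k : ℝ) + ((δ : ℝ) - 1) / δ) * (s - 1) = (k + 1) * s - (k + 1) - s / δ + 1 / δ := by
      field_simp
      ring
    have h6 : (0 : ℝ) < 1 / δ := by positivity
    linarith

/-- Each of the three eigenvalue conditions excludes three disjoint non-empty sets with fewer than
`2 c` outgoing edges, where `c = k + (δ - 1) / δ`. Since `2 c < δ`, such sets have more than `δ`
vertices, and the test vectors they provide give the bound `4 c / (δ + 1) ≤ 16 c / (3 (δ + 1))`. -/
theorem exists_le_edgesBetween_of_eigenvalue {k : ℕ} (hk : 2 * k + 2 ≤ G.minDegree) {a b : ℝ}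
    (hab : 0 < b ∧ 0 ≤ a + b ∧ lam₂ G a b 3 < (a + b) * G.minDegree
        - 16 * b * ((k : ℝ) + ((G.minDegree : ℝ) - 1) / G.minDegree)
          / (3 * ((G.minDegree : ℝ) + 1)) ∨
      b < 0 ∧ a + b ≤ 0 ∧ (a + b) * G.minDegree
        - 16 * b * ((k : ℝ) + ((G.minDegree : ℝ) - 1) / G.minDegree)
          / (3 * ((G.minDegree : ℝ) + 1)) < lam₂ G a b (Fintype.card V - 2))
    (U : Fin 3 → Finset V) (hdisj : ∀ i j, i ≠ j → Disjoint (U i) (U j))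
    (hne : ∀ i, (U i).Nonempty) :
    ∃ i, 2 * ((k : ℝ) + ((G.minDegree : ℝ) - 1) / G.minDegree)
      ≤ (edgesBetween G (U i) (Finset.univ \ U i) : ℝ) := by
  by_contra! hlt
  have hδ : (2 * k + 2 : ℝ) ≤ G.minDegree := by exact_mod_cast hk
  have hk0 : (0 : ℝ) ≤ k := Nat.cast_nonneg k
  have hδ0 : (0 : ℝ) < G.minDegree := by linarith
  have hfrac : ((G.minDegree : ℝ) - 1) / G.minDegree < 1 := by
    rw [div_lt_one hδ0]
    linarith
  have hfrac0 : 0 ≤ ((G.minDegree : ℝ) - 1) / G.minDegree := div_nonneg (by linarith) hδ0.le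
  set c := (k : ℝ) + ((G.minDegree : ℝ) - 1) / G.minDegree with hc
  have hc0 : 0 ≤ c := by positivity
  have hcard : ∀ i, (G.minDegree : ℝ) + 1 ≤ (U i).card := by
    intro i
    have h : (edgesBetween G (U i) (Finset.univ \ U i) : ℝ) < G.minDegree := by
      linarith [hlt i]
    have := minDegree_lt_card_of_edgesBetween_lt G (hne i) (by exact_mod_cast h)
    exact_mod_cast this
  have hV : 3 ≤ Fintype.card V := by
    have h1 : ((U 0).card : ℝ) ≤ Fintype.card V := by exact_mod_cast Finset.card_le_univ _
    have h2 : G.minDegree + 1 ≤ Fintype.card V := by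
      exact_mod_cast (hcard 0).trans h1
    have h3 : 0 < G.degree (hne 0).choose := by
      have := G.minDegree_le_degree (hne 0).choose
      omega
    omega
  have hcoef : 2 * (2 * c) / ((G.minDegree : ℝ) + 1)
      ≤ 16 * c / (3 * ((G.minDegree : ℝ) + 1)) := by
    rw [div_le_div_iff₀ (by positivity) (by positivity)]
    nlinarith [mul_nonneg hc0 (by positivity : (0 : ℝ) ≤ (G.minDegree : ℝ) + 1)]
  have hmul : 16 * b * c / (3 * ((G.minDegree : ℝ) + 1))
      = b * (16 * c / (3 * ((G.minDegree : ℝ) + 1))) := by ring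
  rw [hmul] at hab
  rcases hab with ⟨hb, hab, h⟩ | ⟨hb, hab, h⟩
  · have h1 := le_lam₂ (by norm_num) hV hdisj (by positivity) (by positivity) hcard
      (fun i => (hlt i).le) hb.le hab
    have h2 := mul_le_mul_of_nonneg_left hcoef hb.le
    linarith
  · have h1 := lam₂_le (by norm_num) hV hdisj (by positivity) (by positivity) hcard
      (fun i => (hlt i).le) hb.le hab
    have h2 := mul_le_mul_of_nonpos_left hcoef hb.le
    have h3 : Fintype.card V + 1 - 3 = Fintype.card V - 2 := by omega
    rw [h3] at h1
    linarith

theorem lam_eq_lam₂ (a : ℝ) (i : ℕ) : lam G a i = lam₂ G a 1 i := by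
  have h : degAddAdj G a = degAddSmulAdj G a 1 := by simp [degAddAdj, degAddSmulAdj]
  simp only [lam, lam₂, h]

end

end SpectralPacking

theorem corollary3p1 {V : Type*} [Fintype V] [DecidableEq V] (G : SimpleGraph V)
    [DecidableRel G.Adj] (k δ : ℕ) (hk : 2 ≤ k) (hG : SpectralPacking.InClass 1 G)
    (hδ : G.minDegree = δ) (hδk : 2 * k + 2 ≤ δ)
    (a b : ℝ) (ha : -1 ≤ a) (hb : b ≠ 0) (hab : -1 ≤ a / b)
    (h : SpectralPacking.lam G a 3
            < (a + 1) * δ - 16 * ((k : ℝ) + ((δ : ℝ) - 1) / δ) / (3 * ((δ : ℝ) + 1)) ∨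
        (0 < b ∧ SpectralPacking.lam₂ G a b 3
            < (a + b) * δ - 16 * b * ((k : ℝ) + ((δ : ℝ) - 1) / δ) / (3 * ((δ : ℝ) + 1))) ∨
        (b < 0 ∧ (a + b) * δ - 16 * b * ((k : ℝ) + ((δ : ℝ) - 1) / δ) / (3 * ((δ : ℝ) + 1))
            < SpectralPacking.lam₂ G a b (Fintype.card V - 2))) :
    SpectralPacking.PropertyP G k δ := by
  classical
  open SpectralPacking in
  subst hδ
  obtain ⟨b', hb'⟩ : ∃ b' : ℝ, 0 < b' ∧ 0 ≤ a + b' ∧ lam₂ G a b' 3 < (a + b') * G.minDegree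
        - 16 * b' * ((k : ℝ) + ((G.minDegree : ℝ) - 1) / G.minDegree)
          / (3 * ((G.minDegree : ℝ) + 1)) ∨
      b' < 0 ∧ a + b' ≤ 0 ∧ (a + b') * G.minDegree
        - 16 * b' * ((k : ℝ) + ((G.minDegree : ℝ) - 1) / G.minDegree)
          / (3 * ((G.minDegree : ℝ) + 1)) < lam₂ G a b' (Fintype.card V - 2) := by
    -- The first condition is the second one with `b = 1`.
    rcases h with h | ⟨hpos, h⟩ | ⟨hneg, h⟩
    · rw [lam_eq_lam₂] at h
      exact ⟨1, Or.inl ⟨one_pos, by linarith, by rwa [mul_one]⟩⟩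
    · rw [le_div_iff₀ hpos] at hab
      exact ⟨b, Or.inl ⟨hpos, by linarith, h⟩⟩
    · rw [le_div_iff_of_neg hneg] at hab
      exact ⟨b, Or.inr ⟨hneg, by linarith, h⟩⟩
  have hthree := exists_le_edgesBetween_of_eigenvalue hδk hb'
  have hδ1 : (2 : ℝ) ≤ G.minDegree := by
    have : 2 ≤ G.minDegree := by omega
    exact_mod_cast this
  have hfrac0 : 0 ≤ ((G.minDegree : ℝ) - 1) / G.minDegree := div_nonneg (by linarith) (by linarith)
  have hk0 : (0 : ℝ) < k := by
    have : 0 < k := by omega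
    exact_mod_cast this
  have hc : 0 < (k : ℝ) + ((G.minDegree : ℝ) - 1) / G.minDegree := by positivity
  have hconn := le_edgeConnectivity_of_inClass hG hc hthree
  have hsurj : ∀ R : SimpleGraph V, Function.Surjective R.connectedComponentMk :=
    fun R => Quot.mk_surjective
  have hcross : ∀ R : SimpleGraph V,
      ((k : ℝ) + ((G.minDegree : ℝ) - 1) / G.minDegree) * (Fintype.card R.ConnectedComponent - 1)
        ≤ (crossing G R.connectedComponentMk).edgeSet.ncard :=
    fun R => mul_card_sub_one_le_card_crossing (hsurj R) hc hconn hthree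
  obtain ⟨W, hW, -⟩ := id hG
  obtain ⟨v, -⟩ := (hW 0).1
  have : Nonempty V := ⟨v⟩
  obtain ⟨T, F, hT, hTT, hF, hacyc, hTF, hcard⟩ := exists_trees_and_forest (G := G) (k := k)
    (q := (G.minDegree - 1) * Fintype.card V / G.minDegree)
    (fun R => by
      have h1 := hcross R
      have h2 : (1 : ℝ) ≤ Fintype.card R.ConnectedComponent := by
        exact_mod_cast Fintype.card_pos (α := R.ConnectedComponent)
      have h3 : (k : ℝ) * Fintype.card R.ConnectedComponent
          ≤ (crossing G R.connectedComponentMk).edgeSet.ncard + k := by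
        nlinarith [mul_nonneg hfrac0 (sub_nonneg.mpr h2)]
      rw [Nat.card_eq_fintype_card]
      exact_mod_cast h3)
    (fun R => by
      rw [Nat.card_eq_fintype_card]
      exact add_mul_card_lt_card_crossing (hsurj R) hδk (hcross R))
  -- More than `(δ - 1) n / δ` edges, rather than only `(δ - 1) (n - 1) / δ`, are what forces a
  -- component with at least `δ` edges.
  have hlarge : (G.minDegree - 1) * Fintype.card V < G.minDegree * F.edgeSet.ncard := by
    rw [mul_comm G.minDegree]
    exact (Nat.div_lt_iff_lt_mul (by omega)).mp hcard
  refine ⟨T, F, hT, hTT, hF, hacyc, hTF, ?_, fun _ => exists_component_card_edgeSet_ge hacyc hlarge⟩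
  have hlarge' : ((G.minDegree : ℝ) - 1) * Fintype.card V < G.minDegree * F.edgeSet.ncard := by
    rw [← Nat.cast_one, ← Nat.cast_sub (by omega)]
    exact_mod_cast hlarge
  rw [div_mul_eq_mul_div, div_lt_iff₀ (by linarith)]
  linarith
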